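/- Conventions. An operator system is a closed unital self-adjoint linear subspace $X$ of a nonzero unital $C^*$-algebra; $X_{\rm sa}$ is its self-adjoint part, and u.c.p. means unital completely positive. $M_n$ is the $C^*$-algebra of complex $n\times n$ matrices ($n\ge 1$), and $UCP_n(X)$ is the set of u.c.p. maps $X\to M_n$. $X$ is nuclear if $\mathrm{id}_X$ lies in the point-norm closure of the set of u.c.p. maps $X\to X$ that factor (through u.c.p. maps) through matrix algebras. A Lip-normed operator system $(X,L)$ is an operator system $X$ with a seminorm $L$ on a dense real-linear subspace $\mathcal D(L)\ni 1$ of $X_{\rm sa}$ such that (1) $L(a)=0$ if and only if $a\in\mathbb R1$; (2) the metric $\rho_L(\mu,\nu)=\sup\{|\mu(a)-\nu(a)|: a\in\mathcal D(L),\ L(a)\le 1\}$ induces the weak$^*$ topology on the state space of the order-unit space $\mathcal D(L)$ (its positive unital functionals); and (3) $\mathcal D_1(L)=\{a\in\mathcal D(L):L(a)\le 1\}$ is closed in $X_{\rm sa}$. For $\varphi,\psi\in UCP_n(X)$ put $\rho_{L,n}(\varphi,\psi)=\sup_{x\in\mathcal D_1(L)}\|\varphi(x)-\psi(x)\|$.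 For Lip-normed operator systems $(X,L_X)$ and $(Y,L_Y)$ let $\mathcal M(L_X,L_Y)$ be the set of seminorms $L$ with domain $\mathcal D(L_X)\oplus\mathcal D(L_Y)$ such that $(X\oplus Y,L)$ is a Lip-normed operator system, $L_X(x)=\inf_{y\in\mathcal D(L_Y)} L(x,y)$ for all $x\in\mathcal D(L_X)$, and $L_Y(y)=\inf_{x\in\mathcal D(L_X)} L(x,y)$ for all $y\in\mathcal D(L_Y)$. The complete distance is $$\mathrm{dist}_s(X,Y)=\inf_{L\in\mathcal M(L_X,L_Y)}\ \sup_{n\ge 1}\ \mathrm{dist}_H^{\rho_{L,n}}\bigl(UCP_n(X),UCP_n(Y)\bigr),$$ where $\mathrm{dist}_H^{\rho_{L,n}}$ is the Hausdorff distance with respect to $\rho_{L,n}$ and $UCP_n(X)$, $UCP_n(Y)$ are regarded as subsets of $UCP_n(X\oplus Y)$ by composition with the coordinate projections. For $\epsilon>0$ let $\mathrm{Afn}_L(\epsilon)$ be the smallest integer $k\ge 1$ for which there is a Lip-normed operator system $(Y,L_Y)$ with $Y$ an operator subsystem of $M_k$ and $\mathrm{dist}_s(X,Y)\le\epsilon$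 (and $\infty$ if there is no such $k$). Let $\mathrm{Rcp}_L(\epsilon)$ be the infimum of $\mathrm{rank}(B)$ over all triples $(\alpha,\beta,B)$ where $B$ is a finite-dimensional $C^*$-algebra and $\alpha:X\to B$, $\beta:B\to X$ are u.c.p. maps with $\|\beta(\alpha(x))-x\|<\epsilon$ for all $x\in\mathcal D_1(L)$; here $\mathrm{rank}(B)=n_1+\dots+n_m$ if $B\cong M_{n_1}\oplus\dots\oplus M_{n_m}$. Proposition. If $(X,L)$ is a Lip-normed nuclear operator system and $\epsilon>0$, then $\mathrm{Rcp}_L(\epsilon)\ge\mathrm{Afn}_L(\epsilon)$. -/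

import Mathlib

open scoped ENNReal Topology Matrix.Norms.L2Operator

noncomputable section

/-- Positivity in a star algebra: `a` is of the form `b⋆ b`.  For a C⋆-algebra, and for the
C⋆-algebra of `n × n` matrices over a C⋆-algebra, this is the usual positive cone. -/
def IsPos {R : Type*} [Mul R] [Star R] (a : R) : Prop := ∃ b : R, a = star b * b

/-- The C⋆-algebra `M_n` of `n × n` complex matrices, with the operator norm of its
action on Euclidean space. -/
abbrev MatAlg (n : ℕ) : Type := Matrix (Fin n) (Fin n) ℂ

/-- A (concrete) operator system: a closed unital self-adjoint linear subspace of a unital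
C⋆-algebra. -/
structure OperatorSystem (A : Type*) [CStarAlgebra A] extends Submodule ℂ A where
  one_mem' : (1 : A) ∈ carrier
  star_mem' : ∀ {a : A}, a ∈ carrier → star a ∈ carrier
  isClosed' : IsClosed carrier

namespace OperatorSystem

instance {A : Type*} [CStarAlgebra A] : CoeSort (OperatorSystem A) (Type _) :=
  ⟨fun X => X.toSubmodule⟩

/-- The unit of an operator system. -/
def unit {A : Type*} [CStarAlgebra A] (X : OperatorSystem A) : X := ⟨1, X.one_mem'⟩

/-- A unital C⋆-algebra, regarded as an operator system. -/
def univ (A : Type*) [CStarAlgebra A] : OperatorSystem A where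
  toSubmodule := ⊤
  one_mem' := trivial
  star_mem' := fun _ => trivial
  isClosed' := isClosed_univ

/-- The direct sum `X ⊕ Y`, inside the C⋆-algebra `A ⊕ B` (with the maximum norm). -/
def sum {A B : Type*} [CStarAlgebra A] [CStarAlgebra B]
    (X : OperatorSystem A) (Y : OperatorSystem B) : OperatorSystem (A × B) where
  toSubmodule := X.toSubmodule.prod Y.toSubmodule
  one_mem' := ⟨X.one_mem', Y.one_mem'⟩
  star_mem' := fun h => ⟨X.star_mem' h.1, Y.star_mem' h.2⟩
  isClosed' := X.isClosed'.prod Y.isClosed'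

end OperatorSystem

/-- A unital completely positive map `X → Y` between operator systems: a unital linear map all of
whose matrix amplifications are positive. -/
structure UCPMap {A B : Type*} [CStarAlgebra A] [CStarAlgebra B]
    (X : OperatorSystem A) (Y : OperatorSystem B) where
  toLin : X →ₗ[ℂ] Y
  map_unit : toLin X.unit = Y.unit
  map_pos : ∀ (n : ℕ) (M : Matrix (Fin n) (Fin n) X),
    IsPos (M.map fun x => (x : A)) → IsPos (M.map fun x => (toLin x : B))

namespace UCPMap

/-- Composition of u.c.p. maps. -/
def comp {A B C : Type*} [CStarAlgebra A] [CStarAlgebra B] [CStarAlgebra C]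
    {X : OperatorSystem A} {Y : OperatorSystem B} {Z : OperatorSystem C}
    (ψ : UCPMap Y Z) (φ : UCPMap X Y) : UCPMap X Z where
  toLin := ψ.toLin ∘ₗ φ.toLin
  map_unit := by rw [LinearMap.comp_apply, φ.map_unit, ψ.map_unit]
  map_pos := fun n M hM => ψ.map_pos n (M.map φ.toLin) (φ.map_pos n M hM)

/-- The coordinate projection `X ⊕ Y → X`. -/
def fst {A B : Type*} [CStarAlgebra A] [CStarAlgebra B]
    (X : OperatorSystem A) (Y : OperatorSystem B) : UCPMap (X.sum Y) X where
  toLin :=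
    { toFun := fun p => ⟨(p : A × B).1, p.2.1⟩
      map_add' := fun _ _ => rfl
      map_smul' := fun _ _ => rfl }
  map_unit := rfl
  map_pos := by
    rintro n M ⟨N, hN⟩
    refine ⟨N.map Prod.fst, ?_⟩
    ext i j
    have h := congrArg Prod.fst (congrFun (congrFun hN i) j)
    simpa [Matrix.mul_apply, Matrix.star_apply, Prod.fst_sum] using h

/-- The coordinate projection `X ⊕ Y → Y`. -/
def snd {A B : Type*} [CStarAlgebra A] [CStarAlgebra B]
    (X : OperatorSystem A) (Y : OperatorSystem B) : UCPMap (X.sum Y) Y where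
  toLin :=
    { toFun := fun p => ⟨(p : A × B).2, p.2.2⟩
      map_add' := fun _ _ => rfl
      map_smul' := fun _ _ => rfl }
  map_unit := rfl
  map_pos := by
    rintro n M ⟨N, hN⟩
    refine ⟨N.map Prod.snd, ?_⟩
    ext i j
    have h := congrArg Prod.snd (congrFun (congrFun hN i) j)
    simpa [Matrix.mul_apply, Matrix.star_apply, Prod.snd_sum] using h

end UCPMap

/-- The matrix state space `UCP_n(X)`: the u.c.p. maps `X → M_n`. -/
abbrev UCP {A : Type*} [CStarAlgebra A] (X : OperatorSystem A) (n : ℕ) : Type _ :=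
  UCPMap X (OperatorSystem.univ (MatAlg n))

/-- Nuclearity: the identity map of `X` lies in the point-norm closure (the closure for the
topology of pointwise norm convergence) of the set of u.c.p. maps from `X` to itself which factor
through matrix algebras. -/
def OperatorSystem.IsNuclear {A : Type*} [CStarAlgebra A] (X : OperatorSystem A) : Prop :=
  (id : X → X) ∈ closure {f : X → X | ∃ (k : ℕ) (φ : UCP X k)
    (ψ : UCPMap (OperatorSystem.univ (MatAlg k)) X), f = fun x => ψ.toLin (φ.toLin x)}

/-- The states of a real subspace `D` of (the self-adjoint part of) an operator system, regarded
as an order-unit space: the positive unital real-linear functionals. -/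
structure OrderUnitState {A : Type*} [CStarAlgebra A] {X : OperatorSystem A}
    (D : Submodule ℝ X) where
  toLin : D →ₗ[ℝ] ℝ
  map_unit : ∀ a : D, (a : X) = X.unit → toLin a = 1
  map_pos : ∀ a : D, IsPos ((a : X) : A) → 0 ≤ toLin a

namespace OrderUnitState

/-- The weak⋆ topology on the state space. -/
instance {A : Type*} [CStarAlgebra A] {X : OperatorSystem A} (D : Submodule ℝ X) :
    TopologicalSpace (OrderUnitState D) :=
  TopologicalSpace.induced (fun μ (a : D) => μ.toLin a) inferInstance

/-- The (a priori extended) metric `ρ_L(μ, ν) = sup { |μ(a) - ν(a)| : L(a) ≤ 1 }` on states. -/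
def rho {A : Type*} [CStarAlgebra A] {X : OperatorSystem A} {D : Submodule ℝ X}
    (L : Seminorm ℝ D) (μ ν : OrderUnitState D) : ℝ≥0∞ :=
  ⨆ (a : D) (_ : L a ≤ 1), ENNReal.ofReal |μ.toLin a - ν.toLin a|

end OrderUnitState

/-- The structure of a Lip-normed operator system on `X`: a closed Lip-norm on a dense order-unit
subspace `domain` of `X_sa`. -/
structure LipNorm {A : Type*} [CStarAlgebra A] (X : OperatorSystem A) where
  /-- the domain `𝒟(L)` -/
  domain : Submodule ℝ X
  selfAdjoint : ∀ x ∈ domain, IsSelfAdjoint (x : A)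
  unit_mem : X.unit ∈ domain
  dense : ∀ x : X, IsSelfAdjoint (x : A) → x ∈ closure (domain : Set X)
  /-- the semi-norm `L` -/
  norm : Seminorm ℝ domain
  norm_eq_zero_iff : ∀ a : domain, norm a = 0 ↔ ∃ r : ℝ, (a : X) = r • X.unit
  /-- the metric `ρ_L` induces the weak⋆ topology on the state space of `𝒟(L)` -/
  nhds_basis : ∀ μ : OrderUnitState domain, (𝓝 μ).HasBasis (fun ε : ℝ≥0∞ => 0 < ε)
    fun ε => {ν | OrderUnitState.rho norm ν μ < ε}
  /-- the set `𝒟₁(L)` is closed -/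
  isClosed : IsClosed {x : X | ∃ h : x ∈ domain, norm ⟨x, h⟩ ≤ 1}

namespace LipNorm

/-- The metric `ρ_{L,n}(φ, ψ) = sup { ‖φ(x) - ψ(x)‖ : x ∈ 𝒟₁(L) }` on `UCP_n(X)`. -/
@[reducible] def ucpMetric {A : Type*} [CStarAlgebra A] {X : OperatorSystem A} (L : LipNorm X)
    (n : ℕ) : PseudoEMetricSpace (UCP X n) where
  edist φ ψ := ⨆ (a : L.domain) (_ : L.norm a ≤ 1), ENNReal.ofReal ‖φ.toLin a - ψ.toLin a‖
  edist_self φ := by simp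
  edist_comm φ ψ := by simp only [norm_sub_rev]
  edist_triangle φ ψ θ := by
    refine iSup₂_le fun a ha => ?_
    refine le_trans (ENNReal.ofReal_le_ofReal
      (norm_sub_le_norm_sub_add_norm_sub (φ.toLin a) (ψ.toLin a) (θ.toLin a))) ?_
    rw [ENNReal.ofReal_add (norm_nonneg _) (norm_nonneg _)]
    exact add_le_add
      (le_iSup₂ (f := fun (a : L.domain) (_ : L.norm a ≤ 1) =>
        ENNReal.ofReal ‖φ.toLin a - ψ.toLin a‖) a ha)
      (le_iSup₂ (f := fun (a : L.domain) (_ : L.norm a ≤ 1) =>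
        ENNReal.ofReal ‖ψ.toLin a - θ.toLin a‖) a ha)

/-- `L ∈ ℳ(L_X, L_Y)`: `L` is a closed Lip-norm on `𝒟(L_X) ⊕ 𝒟(L_Y)` which induces `L_X` and
`L_Y` as quotient semi-norms via the two coordinate projections. -/
structure Induces {A B : Type*} [CStarAlgebra A] [CStarAlgebra B]
    {X : OperatorSystem A} {Y : OperatorSystem B} (L : LipNorm (X.sum Y))
    (LX : LipNorm X) (LY : LipNorm Y) : Prop where
  mem_domain_iff : ∀ p : X.sum Y, p ∈ L.domain ↔
    (UCPMap.fst X Y).toLin p ∈ LX.domain ∧ (UCPMap.snd X Y).toLin p ∈ LY.domain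
  fst_quotient : ∀ x : LX.domain,
    IsGLB {r : ℝ | ∃ p : L.domain, (UCPMap.fst X Y).toLin p = x ∧ r = L.norm p} (LX.norm x)
  snd_quotient : ∀ y : LY.domain,
    IsGLB {r : ℝ | ∃ p : L.domain, (UCPMap.snd X Y).toLin p = y ∧ r = L.norm p} (LY.norm y)

/-- The Hausdorff distance, for `ρ_{L,n}`, between (the copies in `UCP_n(X ⊕ Y)` of) `UCP_n(X)`
and `UCP_n(Y)`. -/
def ucpHausdorffDist {A B : Type*} [CStarAlgebra A] [CStarAlgebra B]
    {X : OperatorSystem A} {Y : OperatorSystem B} (L : LipNorm (X.sum Y)) (n : ℕ) : ℝ≥0∞ :=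
  @Metric.hausdorffEDist (UCP (X.sum Y) n) (L.ucpMetric n)
    (Set.range fun φ : UCP X n => φ.comp (UCPMap.fst X Y))
    (Set.range fun ψ : UCP Y n => ψ.comp (UCPMap.snd X Y))

/-- The complete distance `dist_s(X, Y)`. -/
def completeDist {A B : Type*} [CStarAlgebra A] [CStarAlgebra B]
    {X : OperatorSystem A} {Y : OperatorSystem B} (LX : LipNorm X) (LY : LipNorm Y) : ℝ≥0∞ :=
  ⨅ (L : LipNorm (X.sum Y)) (_ : L.Induces LX LY), ⨆ (n : ℕ) (_ : 1 ≤ n), L.ucpHausdorffDist n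

/-- `Afn_L(ε)`: the smallest `k ≥ 1` such that some Lip-normed operator subsystem `Y` of `M_k`
satisfies `dist_s(X, Y) ≤ ε` (and `∞` if there is none). -/
def Afn {A : Type*} [CStarAlgebra A] {X : OperatorSystem A} (L : LipNorm X)
    (ε : ℝ) : ℕ∞ :=
  ⨅ (k : ℕ) (_ : 1 ≤ k) (Y : OperatorSystem (MatAlg k)) (LY : LipNorm Y)
    (_ : completeDist L LY ≤ ENNReal.ofReal ε), (k : ℕ∞)

/-- The collection `CPA_L(ε)` of triples `(α, β, B)` with `B` a finite-dimensional C⋆-algebra,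
`α : X → B` and `β : B → X` u.c.p. maps, and `‖β(α(x)) - x‖ < ε` for all `x ∈ 𝒟₁(L)`.
(Up to isomorphism every finite-dimensional C⋆-algebra lives in `Type`.) -/
structure CPA {A : Type*} [CStarAlgebra A] {X : OperatorSystem A} (L : LipNorm X) (ε : ℝ) where
  B : Type
  [cstarAlgebra : CStarAlgebra B]
  [finiteDimensional : FiniteDimensional ℂ B]
  α : UCPMap X (OperatorSystem.univ B)
  β : UCPMap (OperatorSystem.univ B) X
  approx : ∀ a : L.domain, L.norm a ≤ 1 → ‖β.toLin (α.toLin a) - (a : X)‖ < ε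

end LipNorm

/-- The rank of a finite-dimensional C⋆-algebra `B ≅ M_{n₁} ⊕ ⋯ ⊕ M_{n_m}`, which is
`n₁ + ⋯ + n_m` (the decomposition exists, and is unique up to order and zero summands). -/
def cstarRank (B : Type*) [CStarAlgebra B] : ℕ∞ :=
  ⨅ (m : ℕ) (n : Fin m → ℕ) (_ : Nonempty (B ≃⋆ₐ[ℂ] ((i : Fin m) → MatAlg (n i)))),
    ((∑ i, n i : ℕ) : ℕ∞)

/-- `Rcp_L(ε)`: the infimum of `rank(B)` over the triples `(α, β, B)` in `CPA_L(ε)`. -/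
def LipNorm.Rcp {A : Type*} [CStarAlgebra A] {X : OperatorSystem A}
    (L : LipNorm X) (ε : ℝ) : ℕ∞ :=
  ⨅ t : L.CPA ε, @cstarRank t.B t.cstarAlgebra

end

/-!
An approximation `(α, β, B)` of the identity of `X` itself provides the matrix-sized operator system
close to `X`. If `B` has rank `k`, it embeds block-diagonally in `M_k` by some `ι`, and the candidate
is `Y = ι (α X)`. With `φ = ι ∘ α : X → Y` and `ψ : Y → X` the map which `β` induces on `Y`
(`UCPMap.toImage`, `UCPMap.ofImage`), `ψ ∘ φ` is within `ε` of the identity on the unit ball of `L`.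
Complete positivity of `ψ` holds because injective ⋆-homomorphisms reflect positivity
(`isPos_of_isPos_matrix_map`).

The system `Y` carries the quotient `L_Y` of `L` under `φ` (`LipNorm.quotient`), and `X ⊕ Y` carries
`(x, y) ↦ max (L x) (L_Y y) (‖x - ψ y‖ / ε) (‖φ x - y‖ / ε)` (`LipNorm.bridge`). The bridge induces
`L` and `L_Y` because the pairs `(x, φ x)` have the value `L x` (`LipNorm.bridge_induces`). If a pair
`(x, y)` has value at most `1`, then `‖x - ψ y‖ ≤ ε` and `‖φ x - y‖ ≤ ε`; since u.c.p. maps contract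
self-adjoint elements, a matrix state `θ` of `X` is within `ε` of the matrix state `θ ∘ ψ` of `Y`, and
a matrix state `θ` of `Y` is within `ε` of the matrix state `θ ∘ φ` of `X`, at every matrix size (`LipNorm.ucpHausdorffDist_bridge_le`).

That the quotient and the bridge are Lip-norms rests on Rieffel's criterion: a seminorm metrizes the
weak⋆ topology of the state space if and only if its unit ball is bounded modulo scalars and the
bounded parts of the ball are totally bounded. The direct implication
(`LipNorm.exists_norm_sub_smul_unit_le`, `LipNorm.totallyBounded_boundedBall`) uses compactness of the
state space and the fact that states determine the norm of self-adjoint elements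
(`OrderUnitState.norm_le_of_forall_abs_le`); the converse is `LipNorm.nhds_basis_of_totallyBounded`.
-/

noncomputable section

/-! ### Positivity and u.c.p. maps -/

section Positivity

variable {A : Type*} [CStarAlgebra A]

theorem isPos_iff_nonneg [PartialOrder A] [StarOrderedRing A] {a : A} : IsPos a ↔ 0 ≤ a :=
  CStarAlgebra.nonneg_iff_eq_star_mul_self.symm

theorem IsPos.isSelfAdjoint {R : Type*} [Mul R] [StarMul R] {a : R} (h : IsPos a) :
    IsSelfAdjoint a := by
  obtain ⟨b, rfl⟩ := h
  rw [isSelfAdjoint_iff, star_mul, star_star]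

theorem isSelfAdjoint_real_smul_one (r : ℝ) : IsSelfAdjoint (r • (1 : A)) :=
  (IsSelfAdjoint.all r).smul (IsSelfAdjoint.one A)

theorem isPos_norm_smul_one_sub {a : A} (ha : IsSelfAdjoint a) : IsPos (‖a‖ • (1 : A) - a) := by
  let _ := CStarAlgebra.spectralOrder A
  have := CStarAlgebra.spectralOrderedRing A
  rw [isPos_iff_nonneg, sub_nonneg, ← Algebra.algebraMap_eq_smul_one]
  exact ha.le_algebraMap_norm_self

theorem isPos_norm_smul_one_add {a : A} (ha : IsSelfAdjoint a) : IsPos (‖a‖ • (1 : A) + a) := by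
  simpa using isPos_norm_smul_one_sub ha.neg

theorem norm_le_of_isPos {a : A} {c : ℝ} (hc : 0 ≤ c) (h₁ : IsPos (c • (1 : A) - a))
    (h₂ : IsPos (c • (1 : A) + a)) : ‖a‖ ≤ c := by
  let _ := CStarAlgebra.spectralOrder A
  have := CStarAlgebra.spectralOrderedRing A
  have ha : IsSelfAdjoint a := by
    simpa using (isSelfAdjoint_real_smul_one c).sub h₁.isSelfAdjoint
  rcases subsingleton_or_nontrivial A with _ | _
  · rw [Subsingleton.elim a 0, norm_zero]
    exact hc
  rw [isPos_iff_nonneg, sub_nonneg, ← Algebra.algebraMap_eq_smul_one] at h₁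
  rw [isPos_iff_nonneg, ← neg_le_iff_add_nonneg', ← Algebra.algebraMap_eq_smul_one,
    ← map_neg] at h₂
  rcases CStarAlgebra.norm_or_neg_norm_mem_spectrum ha with h | h
  · exact (le_algebraMap_iff_spectrum_le (ha := ha)).1 h₁ _ h
  · exact neg_le_neg_iff.1 ((algebraMap_le_iff_le_spectrum (ha := ha)).1 h₂ _ h)

/-- An injective ⋆-homomorphism of C⋆-algebras reflects positivity: it is faithful on the negative
part of `a`, which must vanish if `f a` is positive. -/
theorem isPos_of_isPos_map {B : Type*} [CStarAlgebra B] (f : A →⋆ₙₐ[ℂ] B)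
    (hf : Function.Injective f) {a : A} (ha : IsPos (f a)) : IsPos a := by
  let _ := CStarAlgebra.spectralOrder A
  have := CStarAlgebra.spectralOrderedRing A
  let _ := CStarAlgebra.spectralOrder B
  have := CStarAlgebra.spectralOrderedRing B
  have hsa : IsSelfAdjoint a := hf (by rw [map_star, ha.isSelfAdjoint.star_eq])
  have hn : 0 ≤ a⁻ := CFC.negPart_nonneg a
  rw [isPos_iff_nonneg] at ha
  -- Compressing `f a = f a⁺ - f a⁻ ≥ 0` by `f a⁻` gives `-f (a⁻)³ ≥ 0`.
  have h₁ : a⁻ * a * a⁻ = -(a⁻ * a⁻ * a⁻) := by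
    have h : a⁻ * a = -(a⁻ * a⁻) := calc
      a⁻ * a = a⁻ * (a⁺ - a⁻) := by rw [CFC.posPart_sub_negPart a hsa]
      _ = -(a⁻ * a⁻) := by rw [mul_sub, CFC.negPart_mul_posPart, zero_sub]
    rw [h, neg_mul]
  have h₂ : 0 ≤ f (a⁻ * a * a⁻) := by
    have := star_left_conjugate_nonneg ha (f a⁻)
    rwa [← map_star, hn.isSelfAdjoint.star_eq, ← map_mul, ← map_mul] at this
  have h₃ : 0 ≤ f (a⁻ * a⁻ * a⁻) := by
    have h₀ : 0 ≤ f a⁻ := by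
      obtain ⟨b, hb⟩ := isPos_iff_nonneg.2 hn
      rw [hb, map_mul, map_star]
      exact star_mul_self_nonneg _
    have := star_left_conjugate_nonneg h₀ (f a⁻)
    rwa [← map_star, hn.isSelfAdjoint.star_eq, ← map_mul, ← map_mul] at this
  have h₄ : a⁻ * a⁻ * a⁻ = 0 := by
    apply hf
    rw [map_zero]
    refine le_antisymm ?_ h₃
    rwa [h₁, map_neg, neg_nonneg] at h₂
  have h₅ : a⁻ = 0 := by
    have h₆ : a⁻ * a⁻ = 0 := by
      have : star (a⁻ * a⁻) * (a⁻ * a⁻) = 0 := by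
        rw [star_mul, hn.isSelfAdjoint.star_eq, ← mul_assoc, h₄, zero_mul]
      exact CStarRing.star_mul_self_eq_zero_iff _ |>.1 this
    rw [← CStarRing.star_mul_self_eq_zero_iff, hn.isSelfAdjoint.star_eq, h₆]
  rw [isPos_iff_nonneg, ← CFC.posPart_sub_negPart a hsa, h₅, sub_zero]
  exact CFC.posPart_nonneg a

/-- Matrix amplifications of an injective ⋆-homomorphism reflect positivity. -/
theorem isPos_of_isPos_matrix_map {B : Type*} [CStarAlgebra B] (f : A →⋆ₙₐ[ℂ] B)
    (hf : Function.Injective f) {n : ℕ} {M : Matrix (Fin n) (Fin n) A}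
    (hM : IsPos (M.map f)) : IsPos M := by
  let _ := CStarAlgebra.spectralOrder A
  have := CStarAlgebra.spectralOrderedRing A
  let _ := CStarAlgebra.spectralOrder B
  have := CStarAlgebra.spectralOrderedRing B
  obtain ⟨N, hN⟩ := isPos_of_isPos_map (A := CStarMatrix (Fin n) (Fin n) A)
    (B := CStarMatrix (Fin n) (Fin n) B) (CStarMatrix.mapₙₐ f)
    (fun M N h => CStarMatrix.map_injective hf h) (a := M) hM
  exact ⟨N, hN⟩

/-- Matrix amplifications of a ⋆-homomorphism preserve positivity. -/
theorem IsPos.matrix_map {B : Type*} [CStarAlgebra B] (f : A →⋆ₙₐ[ℂ] B)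
    {n : ℕ} {M : Matrix (Fin n) (Fin n) A} (hM : IsPos M) : IsPos (M.map f) := by
  obtain ⟨N, rfl⟩ := hM
  refine ⟨N.map f, ?_⟩
  ext i j
  simp [Matrix.mul_apply, Matrix.star_apply, map_star]

end Positivity

namespace OperatorSystem

variable {A : Type*} [CStarAlgebra A] (X : OperatorSystem A)

@[simp] theorem coe_unit : (X.unit : A) = 1 := rfl

instance : CompleteSpace X := X.isClosed'.completeSpace_coe

/-- Every element of an operator system is `a + i b` with `a`, `b` self-adjoint in the system and
of no larger norm. -/
theorem exists_re_im (x : X) : ∃ a b : X, IsSelfAdjoint (a : A) ∧ IsSelfAdjoint (b : A) ∧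
    ‖a‖ ≤ ‖x‖ ∧ ‖b‖ ≤ ‖x‖ ∧ x = a + Complex.I • b := by
  have hs : ∀ z : X, star (z : A) ∈ X.toSubmodule := fun z => X.star_mem' z.2
  have hre : (realPart (x : A) : A) ∈ X.toSubmodule := by
    rw [realPart_apply_coe, ← Complex.coe_smul]
    exact X.smul_mem _ (X.add_mem x.2 (hs x))
  have him : (imaginaryPart (x : A) : A) ∈ X.toSubmodule := by
    rw [imaginaryPart_apply_coe, ← Complex.coe_smul]
    exact X.smul_mem _ (X.smul_mem _ (X.sub_mem x.2 (hs x)))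
  refine ⟨⟨_, hre⟩, ⟨_, him⟩, (realPart (x : A)).2, (imaginaryPart (x : A)).2,
    realPart.norm_le (x : A), imaginaryPart.norm_le (x : A), ?_⟩
  exact Subtype.ext (realPart_add_I_smul_imaginaryPart (x : A)).symm

end OperatorSystem

namespace UCPMap

variable {A B : Type*} [CStarAlgebra A] [CStarAlgebra B] {X : OperatorSystem A}
  {Y : OperatorSystem B} (φ : UCPMap X Y)

theorem isPos_map {x : X} (hx : IsPos (x : A)) : IsPos (φ.toLin x : B) := by
  obtain ⟨b, hb⟩ := hx
  obtain ⟨N, hN⟩ := φ.map_pos 1 (Matrix.of fun _ _ => x) ⟨Matrix.of fun _ _ => b, by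
    ext i j
    simpa [Matrix.mul_apply] using hb⟩
  refine ⟨N 0 0, ?_⟩
  simpa [Matrix.mul_apply] using congrFun (congrFun hN 0) 0

theorem map_real_smul (r : ℝ) (x : X) : φ.toLin (r • x) = r • φ.toLin x :=
  LinearMap.map_smul_of_tower φ.toLin r x

theorem map_real_smul_unit (r : ℝ) : φ.toLin (r • X.unit) = r • Y.unit := by
  rw [map_real_smul, φ.map_unit]

theorem isPos_norm_sub {x : X} (hx : IsSelfAdjoint (x : A)) :
    IsPos (‖x‖ • (1 : B) - φ.toLin x) := by
  have := φ.isPos_map (x := ‖x‖ • X.unit - x) (isPos_norm_smul_one_sub hx)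
  rwa [map_sub, map_real_smul_unit] at this

theorem isPos_norm_add {x : X} (hx : IsSelfAdjoint (x : A)) :
    IsPos (‖x‖ • (1 : B) + φ.toLin x) := by
  have := φ.isPos_map (x := ‖x‖ • X.unit + x) (isPos_norm_smul_one_add hx)
  rwa [map_add, map_real_smul_unit] at this

theorem isSelfAdjoint_map {x : X} (hx : IsSelfAdjoint (x : A)) :
    IsSelfAdjoint (φ.toLin x : B) := by
  simpa using (isSelfAdjoint_real_smul_one ‖x‖).sub (φ.isPos_norm_sub hx).isSelfAdjoint

theorem norm_map_le {x : X} (hx : IsSelfAdjoint (x : A)) : ‖φ.toLin x‖ ≤ ‖x‖ :=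
  norm_le_of_isPos (norm_nonneg x) (φ.isPos_norm_sub hx) (φ.isPos_norm_add hx)

theorem continuous : Continuous φ.toLin := by
  refine (φ.toLin.mkContinuous 2 fun x => ?_).continuous
  obtain ⟨a, b, ha, hb, hna, hnb, h⟩ := X.exists_re_im x
  calc ‖φ.toLin x‖ = ‖φ.toLin a + Complex.I • φ.toLin b‖ := by rw [h, map_add, map_smul]
    _ ≤ ‖φ.toLin a‖ + ‖φ.toLin b‖ := (norm_add_le _ _).trans (by rw [norm_smul]; simp)
    _ ≤ ‖x‖ + ‖x‖ := add_le_add ((φ.norm_map_le ha).trans hna) ((φ.norm_map_le hb).trans hnb)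
    _ = 2 * ‖x‖ := by ring

theorem toLin_star (x : X) :
    (φ.toLin ⟨star (x : A), X.star_mem' x.2⟩ : B) = star (φ.toLin x : B) := by
  obtain ⟨a, b, ha, hb, -, -, h⟩ := X.exists_re_im x
  have h' : (⟨star (x : A), X.star_mem' x.2⟩ : X) = a - Complex.I • b := by
    apply Subtype.ext
    simp [h, ha.star_eq, hb.star_eq, sub_eq_add_neg]
  rw [h', h]
  simp [(φ.isSelfAdjoint_map ha).star_eq, (φ.isSelfAdjoint_map hb).star_eq, sub_eq_add_neg]

end UCPMap

/-! ### States of order-unit subspaces -/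

namespace OrderUnitState

variable {A : Type*} [CStarAlgebra A] {X : OperatorSystem A} {D : Submodule ℝ X}

theorem map_sub_smul_unit (μ : OrderUnitState D) (hu : X.unit ∈ D) (a : D) (r : ℝ) :
    μ.toLin (a - r • ⟨X.unit, hu⟩) = μ.toLin a - r := by
  rw [map_sub, map_smul, μ.map_unit ⟨X.unit, hu⟩ rfl, smul_eq_mul, mul_one]

theorem abs_le_norm (μ : OrderUnitState D) (hu : X.unit ∈ D) {a : D}
    (ha : IsSelfAdjoint ((a : X) : A)) : |μ.toLin a| ≤ ‖(a : X)‖ := by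
  have h₁ := μ.map_pos (‖(a : X)‖ • (⟨X.unit, hu⟩ : D) - a) (isPos_norm_smul_one_sub ha)
  have h₂ := μ.map_pos (‖(a : X)‖ • (⟨X.unit, hu⟩ : D) + a) (isPos_norm_smul_one_add ha)
  rw [map_sub, map_smul, μ.map_unit ⟨X.unit, hu⟩ rfl, smul_eq_mul, mul_one] at h₁
  rw [map_add, map_smul, μ.map_unit ⟨X.unit, hu⟩ rfl, smul_eq_mul, mul_one] at h₂
  exact abs_le.2 ⟨by linarith, by linarith⟩

/-- A self-adjoint element outside the closed cone of positive elements is separated from it by a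
functional, which is a state after normalization. -/
theorem exists_map_neg {a : D} (ha : IsSelfAdjoint ((a : X) : A)) (hn : ¬ IsPos ((a : X) : A)) :
    ∃ μ : OrderUnitState D, μ.toLin a < 0 := by
  let _ := CStarAlgebra.spectralOrder A
  have := CStarAlgebra.spectralOrderedRing A
  obtain ⟨f, hf, hfa⟩ := (ProperCone.positive ℝ A).hyperplane_separation_point
    (x₀ := ((a : X) : A)) (by rwa [ProperCone.mem_positive, ← isPos_iff_nonneg])
  have hpos : ∀ b : A, IsPos b → 0 ≤ f b := fun b hb =>
    hf b (by rwa [ProperCone.mem_positive, ← isPos_iff_nonneg])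
  have h₁ : 0 < f 1 := by
    have h := hpos _ (isPos_norm_smul_one_add ha)
    rw [map_add, map_smul, smul_eq_mul] at h
    exact pos_of_mul_pos_right (a := ‖((a : X) : A)‖) (by linarith) (norm_nonneg _)
  refine ⟨⟨(f 1)⁻¹ • (f.toLinearMap ∘ₗ X.toSubmodule.subtype.restrictScalars ℝ ∘ₗ D.subtype),
    fun b hb => ?_, fun b hb => ?_⟩, ?_⟩
  · simp [hb, h₁.ne']
  · exact mul_nonneg (inv_pos.2 h₁).le (hpos _ hb)
  · exact mul_neg_of_pos_of_neg (inv_pos.2 h₁) hfa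

/-- The states determine the norm of self-adjoint elements. -/
theorem norm_le_of_forall_abs_le (hu : X.unit ∈ D) {a : D} (ha : IsSelfAdjoint ((a : X) : A))
    {c : ℝ} (hc : 0 ≤ c) (h : ∀ μ : OrderUnitState D, |μ.toLin a| ≤ c) : ‖(a : X)‖ ≤ c := by
  refine norm_le_of_isPos hc ?_ ?_ <;> by_contra hn
  · obtain ⟨μ, hμ⟩ := exists_map_neg (a := c • ⟨X.unit, hu⟩ - a)
      ((isSelfAdjoint_real_smul_one c).sub ha) hn
    rw [map_sub, map_smul, μ.map_unit ⟨X.unit, hu⟩ rfl, smul_eq_mul, mul_one] at hμ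
    linarith [(abs_le.1 (h μ)).2]
  · obtain ⟨μ, hμ⟩ := exists_map_neg (a := c • ⟨X.unit, hu⟩ + a)
      ((isSelfAdjoint_real_smul_one c).add ha) hn
    rw [map_add, map_smul, μ.map_unit ⟨X.unit, hu⟩ rfl, smul_eq_mul, mul_one] at hμ
    linarith [(abs_le.1 (h μ)).1]

theorem nonempty [Nontrivial A] (hu : X.unit ∈ D) : Nonempty (OrderUnitState D) := by
  let _ := CStarAlgebra.spectralOrder A
  have := CStarAlgebra.spectralOrderedRing A
  obtain ⟨μ, -⟩ := exists_map_neg (a := -⟨X.unit, hu⟩) (IsSelfAdjoint.one A).neg (fun h => by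
    rw [isPos_iff_nonneg] at h
    have h' : (0 : A) ≤ -1 := h
    exact one_ne_zero (le_antisymm (neg_nonneg.1 h') zero_le_one))
  exact ⟨μ⟩

theorem isInducing_toLin :
    Topology.IsInducing fun (μ : OrderUnitState D) (a : D) => μ.toLin a := ⟨rfl⟩

theorem compactSpace (hsa : ∀ x ∈ D, IsSelfAdjoint (x : A)) (hu : X.unit ∈ D) :
    CompactSpace (OrderUnitState D) := by
  refine ⟨isInducing_toLin.isCompact_iff.2 ?_⟩
  refine (isCompact_univ_pi fun a : D =>
    isCompact_Icc (a := -‖(a : X)‖) (b := ‖(a : X)‖)).of_isClosed_subset ?_ ?_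
  · have : (fun (μ : OrderUnitState D) (a : D) => μ.toLin a) '' Set.univ =
        {g : D → ℝ | (∀ a b, g (a + b) = g a + g b) ∧ (∀ (r : ℝ) a, g (r • a) = r • g a) ∧
          (∀ a : D, (a : X) = X.unit → g a = 1) ∧ ∀ a : D, IsPos ((a : X) : A) → 0 ≤ g a} := by
      ext g
      constructor
      · rintro ⟨μ, -, rfl⟩
        exact ⟨fun a b => map_add _ _ _, fun r a => map_smul _ _ _, μ.map_unit, μ.map_pos⟩
      · rintro ⟨h₁, h₂, h₃, h₄⟩
        exact ⟨⟨⟨⟨g, h₁⟩, h₂⟩, h₃, h₄⟩, trivial, rfl⟩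
    rw [this]
    simp only [Set.ofPred_and, Set.ofPred_forall]
    refine IsClosed.inter ?_ (IsClosed.inter ?_ (IsClosed.inter ?_ ?_))
    · exact isClosed_iInter fun a => isClosed_iInter fun b =>
        isClosed_eq (by fun_prop) (by fun_prop)
    · exact isClosed_iInter fun r => isClosed_iInter fun a =>
        isClosed_eq (by fun_prop) (by fun_prop)
    · exact isClosed_iInter fun a => isClosed_iInter fun _ =>
        isClosed_eq (by fun_prop) (by fun_prop)
    · exact isClosed_iInter fun a => isClosed_iInter fun _ =>
        isClosed_le (by fun_prop) (by fun_prop)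
  · rintro _ ⟨μ, -, rfl⟩ a -
    exact abs_le.1 (μ.abs_le_norm hu (hsa a a.2))

theorem rho_le_ofReal_iff {L : Seminorm ℝ D} {μ ν : OrderUnitState D} {c : ℝ} (hc : 0 ≤ c) :
    rho L μ ν ≤ ENNReal.ofReal c ↔ ∀ a, L a ≤ 1 → |μ.toLin a - ν.toLin a| ≤ c := by
  simp only [rho, iSup_le_iff, ENNReal.ofReal_le_ofReal_iff hc]

/-- The convex combination `(1 - t) μ + t ν`. -/
def mix (μ ν : OrderUnitState D) (t : ℝ) (h₀ : 0 ≤ t) (h₁ : t ≤ 1) : OrderUnitState D where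
  toLin := (1 - t) • μ.toLin + t • ν.toLin
  map_unit a ha := by simp [μ.map_unit a ha, ν.map_unit a ha]
  map_pos a ha := add_nonneg (mul_nonneg (sub_nonneg.2 h₁) (μ.map_pos a ha))
    (mul_nonneg h₀ (ν.map_pos a ha))

end OrderUnitState

/-! ### Lip-norms and total boundedness -/

namespace LipNorm

open OrderUnitState

variable {A : Type*} [CStarAlgebra A] {X : OperatorSystem A} (L : LipNorm X)

theorem norm_real_smul_unit (a : L.domain) (r : ℝ) (ha : (a : X) = r • X.unit) : L.norm a = 0 :=
  (L.norm_eq_zero_iff a).2 ⟨r, ha⟩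

/-- The set `{x : L(x) ≤ 1, ‖x‖ ≤ K}`. -/
def boundedBall (K : ℝ) : Set X := {x | (∃ h : x ∈ L.domain, L.norm ⟨x, h⟩ ≤ 1) ∧ ‖x‖ ≤ K}

/-- The state space is totally bounded for `ρ_L`: it is weak⋆ compact, and `ρ_L`-balls are weak⋆
neighbourhoods of their centres. -/
theorem exists_finite_net {ε : ℝ} (hε : 0 < ε) : ∃ T : Finset (OrderUnitState L.domain),
    ∀ ν : OrderUnitState L.domain, ∃ μ ∈ T, ∀ a, L.norm a ≤ 1 → |ν.toLin a - μ.toLin a| ≤ ε := by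
  have := compactSpace L.selfAdjoint L.unit_mem
  obtain ⟨T, -, hT⟩ := (isCompact_univ (X := OrderUnitState L.domain)).elim_nhds_subcover
    (fun μ => {ν | rho L.norm ν μ < ENNReal.ofReal ε})
    fun μ _ => (L.nhds_basis μ).mem_of_mem (ENNReal.ofReal_pos.2 hε)
  refine ⟨T, fun ν => ?_⟩
  obtain ⟨μ, hμ, h⟩ := Set.mem_iUnion₂.1 (hT (Set.mem_univ ν))
  exact ⟨μ, hμ, (rho_le_ofReal_iff hε.le).1 (le_of_lt h)⟩

/-- Two states are at finite `ρ_L`-distance: states on the segment from `μ` to `ν` which are close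
to `μ` are at distance less than `1` from `μ`, and distances scale along the segment. -/
theorem exists_abs_sub_le (μ ν : OrderUnitState L.domain) :
    ∃ C : ℝ, 0 ≤ C ∧ ∀ a, L.norm a ≤ 1 → |ν.toLin a - μ.toLin a| ≤ C := by
  have ht₀ : ∀ n : ℕ, 0 ≤ 1 / ((n : ℝ) + 1) := fun n => by positivity
  have ht₁ : ∀ n : ℕ, 1 / ((n : ℝ) + 1) ≤ 1 := fun n => by
    rw [div_le_one (by positivity)]
    linarith [n.cast_nonneg (α := ℝ)]
  have hlim : Filter.Tendsto (fun n : ℕ => mix μ ν _ (ht₀ n) (ht₁ n)) Filter.atTop (𝓝 μ) := by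
    rw [isInducing_toLin.tendsto_nhds_iff, tendsto_pi_nhds]
    intro a
    have h := tendsto_one_div_add_atTop_nhds_zero_nat (𝕜 := ℝ)
    have h' := ((tendsto_const_nhds (x := (1 : ℝ))).sub h |>.mul_const (μ.toLin a)).add
      (h.mul_const (ν.toLin a))
    simpa [mix] using h'
  obtain ⟨n, hn⟩ := (hlim.eventually
    ((L.nhds_basis μ).mem_of_mem (i := ENNReal.ofReal 1) (by simp))).exists
  refine ⟨n + 1, by positivity, fun a ha => ?_⟩
  have h := (rho_le_ofReal_iff zero_le_one).1 (le_of_lt hn) a ha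
  have e : (mix μ ν _ (ht₀ n) (ht₁ n)).toLin a - μ.toLin a =
      1 / ((n : ℝ) + 1) * (ν.toLin a - μ.toLin a) := by
    simp only [mix, LinearMap.add_apply, LinearMap.smul_apply, smul_eq_mul]
    ring
  rw [e, abs_mul, abs_of_nonneg (ht₀ n), one_div, inv_mul_le_iff₀ (by positivity), mul_one] at h
  exact h

theorem exists_norm_sub_smul_unit_le [Nontrivial A] : ∃ R : ℝ, 0 ≤ R ∧
    ∀ a : L.domain, L.norm a ≤ 1 → ∃ r : ℝ, ‖(a : X) - r • X.unit‖ ≤ R := by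
  obtain ⟨μ⟩ := OrderUnitState.nonempty L.unit_mem
  obtain ⟨T, hT⟩ := L.exists_finite_net one_pos
  choose C hC₀ hC using L.exists_abs_sub_le μ
  have hR : 0 ≤ 1 + ∑ ν ∈ T, C ν := by
    have := Finset.sum_nonneg fun ν (_ : ν ∈ T) => hC₀ ν
    linarith
  refine ⟨1 + ∑ ν ∈ T, C ν, hR, fun a ha => ⟨μ.toLin a, ?_⟩⟩
  refine norm_le_of_forall_abs_le (a := a - μ.toLin a • ⟨X.unit, L.unit_mem⟩) L.unit_mem
    (L.selfAdjoint _ (Subtype.property _)) hR fun ν => ?_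
  rw [map_sub_smul_unit]
  obtain ⟨ν', hν', h⟩ := hT ν
  calc |ν.toLin a - μ.toLin a| ≤ |ν.toLin a - ν'.toLin a| + |ν'.toLin a - μ.toLin a| :=
        abs_sub_le _ _ _
    _ ≤ 1 + ∑ ν ∈ T, C ν := add_le_add (h a ha)
        ((hC ν' a ha).trans (Finset.single_le_sum (fun ν _ => hC₀ ν) hν'))

/-- The values on a finite `ρ_L`-net of states determine an element with `L(x) ≤ 1` up to a small
error in norm, and bounded sets of such values are totally bounded. -/
theorem totallyBounded_boundedBall (K : ℝ) : TotallyBounded (L.boundedBall K) := by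
  refine Metric.totallyBounded_of_finite_discretization fun ε hε => ?_
  have hδ : 0 < ε / 5 := by positivity
  obtain ⟨T, hT⟩ := L.exists_finite_net hδ
  let Φ : L.boundedBall K → T → ℝ := fun x μ => μ.1.toLin ⟨x.1, x.2.1.1⟩
  have hb : TotallyBounded (Set.range Φ) := by
    refine ((Metric.isBounded_iff_subset_closedBall 0).2
      ⟨|K|, ?_⟩).isCompact_closure.totallyBounded.subset subset_closure
    rintro _ ⟨x, rfl⟩
    rw [mem_closedBall_zero_iff, pi_norm_le_iff_of_nonneg (abs_nonneg K)]
    exact fun μ => (μ.1.abs_le_norm L.unit_mem (L.selfAdjoint _ x.2.1.1)).trans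
      (x.2.2.trans (le_abs_self K))
  obtain ⟨t, ht, hcov⟩ := Metric.totallyBounded_iff.1 hb (ε / 5) hδ
  have hnet : ∀ x, ∃ y : t, dist (Φ x) y < ε / 5 := fun x => by
    obtain ⟨y, hy, h⟩ := Set.mem_iUnion₂.1 (hcov ⟨x, rfl⟩)
    exact ⟨⟨y, hy⟩, h⟩
  choose F hF using hnet
  have : Fintype t := ht.fintype
  let e := Fintype.equivFin t
  refine ⟨ULift (Fin (Fintype.card t)), inferInstance, fun x => ⟨e (F x)⟩, fun x y hxy => ?_⟩
  have hxy' : F x = F y := e.injective (ULift.up_injective hxy)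
  have hd : dist (Φ x) (Φ y) ≤ 2 * (ε / 5) := by
    have h₁ := hF x
    have h₂ := hF y
    rw [← hxy'] at h₂
    linarith [dist_triangle_right (Φ x) (Φ y) (F x)]
  have hc : 0 ≤ 4 * (ε / 5) := by positivity
  have hle : ‖x.1 - y.1‖ ≤ 4 * (ε / 5) := by
    refine norm_le_of_forall_abs_le (a := ⟨x.1, x.2.1.1⟩ - ⟨y.1, y.2.1.1⟩) L.unit_mem
      (L.selfAdjoint _ (Subtype.property _)) hc fun ν => ?_
    obtain ⟨μ, hμ, h⟩ := hT ν
    have h₁ := abs_le.1 (h ⟨x.1, x.2.1.1⟩ x.2.1.2)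
    have h₂ := abs_le.1 (h ⟨y.1, y.2.1.1⟩ y.2.1.2)
    have h₃ := (dist_le_pi_dist (Φ x) (Φ y) ⟨μ, hμ⟩).trans hd
    rw [Real.dist_eq] at h₃
    have h₃ := abs_le.1 h₃
    simp only [Φ] at h₃
    rw [map_sub, abs_le]
    constructor <;> linarith
  calc dist x y = ‖x.1 - y.1‖ := dist_eq_norm x.1 y.1
    _ < ε := by linarith

theorem isCompact_boundedBall (K : ℝ) : IsCompact (L.boundedBall K) :=
  (L.totallyBounded_boundedBall K).isCompact_of_isClosed
    (L.isClosed.inter (isClosed_le continuous_norm continuous_const))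

/-- A seminorm vanishing at the unit, whose unit ball is bounded modulo scalars and has totally
bounded bounded parts, metrizes the weak⋆ topology of the state space. -/
theorem nhds_basis_of_totallyBounded {D : Submodule ℝ X}
    (hsa : ∀ x ∈ D, IsSelfAdjoint (x : A)) (hu : X.unit ∈ D) (p : Seminorm ℝ D)
    (hp : p ⟨X.unit, hu⟩ = 0) {R : ℝ}
    (hR : ∀ a : D, p a ≤ 1 → ∃ r : ℝ, ‖(a : X) - r • X.unit‖ ≤ R)
    (htb : TotallyBounded {x : X | (∃ h : x ∈ D, p ⟨x, h⟩ ≤ 1) ∧ ‖x‖ ≤ R})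
    (μ : OrderUnitState D) :
    (𝓝 μ).HasBasis (fun ε : ℝ≥0∞ => 0 < ε) fun ε => {ν | rho p ν μ < ε} := by
  refine ⟨fun s => ⟨fun hs => ?_, ?_⟩⟩
  · rw [isInducing_toLin.nhds_eq_comap, nhds_pi, Filter.mem_comap] at hs
    obtain ⟨U, hU, hUs⟩ := hs
    obtain ⟨I, hI, V, hV, hVU⟩ := Filter.mem_pi.1 hU
    -- Each basic neighbourhood constrains finitely many `a`, and each `a` is a multiple of a
    -- member of the unit ball of `p`.
    have hev : ∀ᶠ δ : ℝ in 𝓝[>] 0, ∀ a ∈ I,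
        Metric.closedBall (μ.toLin a) ((p a + 1) * δ) ⊆ V a := by
      rw [hI.eventually_all]
      intro a _
      obtain ⟨η, hη, hηV⟩ := Metric.nhds_basis_closedBall.mem_iff.1 (hV a)
      have hlim : Filter.Tendsto (fun δ : ℝ => (p a + 1) * δ) (𝓝[>] 0) (𝓝 0) := by
        refine Filter.Tendsto.mono_left ?_ nhdsWithin_le_nhds
        have : Continuous fun δ : ℝ => (p a + 1) * δ := by fun_prop
        simpa using this.tendsto 0
      filter_upwards [hlim.eventually (Iio_mem_nhds hη)] with δ hδ
      exact (Metric.closedBall_subset_closedBall (le_of_lt hδ)).trans hηV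
    obtain ⟨δ, hδ, hδ₀⟩ := (hev.and self_mem_nhdsWithin).exists
    replace hδ₀ : 0 < δ := hδ₀
    refine ⟨ENNReal.ofReal δ, ENNReal.ofReal_pos.2 hδ₀,
      fun ν hν => hUs (hVU fun a ha => hδ a ha ?_)⟩
    have hpa : 0 < p a + 1 := by linarith [apply_nonneg p a]
    have h := (rho_le_ofReal_iff hδ₀.le).1 (le_of_lt hν) ((p a + 1)⁻¹ • a) (by
      rw [map_smul_eq_mul, Real.norm_eq_abs, abs_of_pos (inv_pos.2 hpa), inv_mul_le_iff₀ hpa]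
      linarith)
    rw [map_smul, map_smul, ← smul_sub, smul_eq_mul, abs_mul, abs_of_pos (inv_pos.2 hpa),
      inv_mul_le_iff₀ hpa] at h
    rwa [Metric.mem_closedBall, Real.dist_eq]
  · rintro ⟨ε, hε, hεs⟩
    refine Filter.mem_of_superset ?_ hεs
    obtain ⟨δ, hδ₀, hδε⟩ : ∃ δ : ℝ, 0 < δ ∧ ENNReal.ofReal (3 * δ) < ε := by
      obtain ⟨c, hc₀, hcε⟩ := ENNReal.lt_iff_exists_nnreal_btwn.1 hε
      refine ⟨c / 3, by have := ENNReal.coe_pos.1 hc₀; positivity, ?_⟩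
      rw [mul_div_cancel₀ _ (by norm_num), ENNReal.ofReal_coe_nnreal]
      exact hcε
    -- Two states which agree within `δ` on a finite `δ`-net of the bounded part agree within `3 δ` on
    -- it, and hence on the unit ball, as states take the same values on scalars.
    obtain ⟨t, hts, ht, hcov⟩ := Metric.finite_approx_of_totallyBounded htb δ hδ₀
    have hev : ∀ᶠ ν in 𝓝 μ, ∀ y ∈ t, ∀ h : y ∈ D, |ν.toLin ⟨y, h⟩ - μ.toLin ⟨y, h⟩| < δ := by
      rw [ht.eventually_all]
      intro y hy
      obtain ⟨h, -⟩ := (hts hy).1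
      have hc : Filter.Tendsto (fun ν : OrderUnitState D => ν.toLin ⟨y, h⟩) (𝓝 μ)
          (𝓝 (μ.toLin ⟨y, h⟩)) :=
        tendsto_pi_nhds.1 (isInducing_toLin.continuous.tendsto μ) ⟨y, h⟩
      filter_upwards [hc (Metric.ball_mem_nhds _ hδ₀)] with ν hν h'
      exact hν
    filter_upwards [hev] with ν hν
    refine lt_of_le_of_lt ((rho_le_ofReal_iff (by positivity)).2 fun a ha => ?_) hδε
    obtain ⟨r, hr⟩ := hR a ha
    have hb : p (a - r • ⟨X.unit, hu⟩) ≤ 1 :=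
      (map_sub_le_add p _ _).trans (by rw [map_smul_eq_mul, hp, mul_zero, add_zero]; exact ha)
    obtain ⟨y, hy, hay⟩ := Set.mem_iUnion₂.1 (hcov
      (show ((a - r • ⟨X.unit, hu⟩ : D) : X) ∈ _ from ⟨⟨Subtype.property _, hb⟩, hr⟩))
    obtain ⟨hyD, -⟩ := (hts hy).1
    have key : ∀ θ : OrderUnitState D, |θ.toLin a - r - θ.toLin ⟨y, hyD⟩| ≤ δ := fun θ => by
      rw [← map_sub_smul_unit θ hu, ← map_sub]
      refine (θ.abs_le_norm hu (hsa _ (Subtype.property _))).trans (le_of_lt ?_)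
      rw [Metric.mem_ball, dist_eq_norm] at hay
      exact hay
    have h₁ := abs_le.1 (key ν)
    have h₂ := abs_le.1 (key μ)
    have h₃ := abs_le.1 (hν y hy hyD).le
    rw [abs_le]
    constructor <;> linarith

end LipNorm

/-! ### Quotient Lip-norms -/

section Quotient

open scoped Pointwise

namespace Seminorm

variable {E F : Type*} [AddCommGroup E] [Module ℝ E] [AddCommGroup F] [Module ℝ F]

theorem absorbent_image_ball (p : Seminorm ℝ E) (f : E →ₗ[ℝ] F) (hf : Function.Surjective f) :
    Absorbent ℝ (f '' p.ball 0 1) := fun y => by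
  obtain ⟨x, rfl⟩ := hf y
  filter_upwards [p.absorbent_ball_zero one_pos x] with a ha
  rw [← Set.image_singleton, ← image_smul_set]
  exact Set.image_mono ha

/-- The quotient seminorm `y ↦ inf {p x : f x = y}` along a surjective linear map `f`, encoded as
the gauge of the image of the open unit ball. -/
def quotientMap (p : Seminorm ℝ E) (f : E →ₗ[ℝ] F) (hf : Function.Surjective f) :
    Seminorm ℝ F :=
  gaugeSeminorm (𝕜 := ℝ) (s := f '' p.ball 0 1)
    (fun a ha => by
      rw [← image_smul_set]
      exact Set.image_mono (p.balanced_ball_zero 1 a ha))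
    ((p.convex_ball 0 1).linear_image f)
    (p.absorbent_image_ball f hf)

variable (p : Seminorm ℝ E) (f : E →ₗ[ℝ] F) (hf : Function.Surjective f)

theorem quotientMap_apply_le (x : E) : p.quotientMap f hf (f x) ≤ p x := by
  refine le_of_forall_gt fun t ht => ?_
  obtain ⟨s, hs, hst⟩ := exists_between ht
  have hs₀ : 0 < s := (apply_nonneg p x).trans_lt hs
  refine lt_of_le_of_lt (gauge_le_of_mem hs₀.le ?_) hst
  rw [← image_smul_set]
  refine ⟨x, ?_, rfl⟩
  rw [Set.mem_smul_set_iff_inv_smul_mem₀ hs₀.ne', mem_ball_zero, map_smul_eq_mul,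
    Real.norm_eq_abs, abs_of_pos (inv_pos.2 hs₀), inv_mul_lt_iff₀ hs₀, mul_one]
  exact hs

theorem exists_lt_of_quotientMap_lt {y : F} {t : ℝ} (h : p.quotientMap f hf y < t) :
    ∃ x, f x = y ∧ p x < t := by
  obtain ⟨s, hs₀, hst, hy⟩ := exists_lt_of_gauge_lt (p.absorbent_image_ball f hf) h
  rw [← image_smul_set] at hy
  obtain ⟨x, hx, rfl⟩ := hy
  refine ⟨x, rfl, lt_trans ?_ hst⟩
  rwa [Set.mem_smul_set_iff_inv_smul_mem₀ hs₀.ne', mem_ball_zero, map_smul_eq_mul,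
    Real.norm_eq_abs, abs_of_pos (inv_pos.2 hs₀), inv_mul_lt_iff₀ hs₀, mul_one] at hx

end Seminorm

namespace UCPMap

variable {A B : Type*} [CStarAlgebra A] [CStarAlgebra B] {X : OperatorSystem A}
  {Y : OperatorSystem B} (φ : UCPMap X Y)

/-- A u.c.p. map as a real-linear map. -/
def toRealLin : X →ₗ[ℝ] Y := φ.toLin.restrictScalars ℝ

theorem norm_map_sub_smul_unit_le {x : X} (hx : IsSelfAdjoint (x : A)) (r : ℝ) :
    ‖φ.toLin x - r • Y.unit‖ ≤ ‖x - r • X.unit‖ := by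
  rw [← φ.map_real_smul_unit, ← map_sub]
  exact φ.norm_map_le (hx.sub (isSelfAdjoint_real_smul_one r))

end UCPMap

namespace LipNorm

variable {A B : Type*} [CStarAlgebra A] [CStarAlgebra B] {X : OperatorSystem A}
  {Y : OperatorSystem B} (L : LipNorm X)

theorem exists_norm_sub_smul_unit_le_mul [Nontrivial A] : ∃ R : ℝ, 0 ≤ R ∧
    ∀ a : L.domain, ∃ r : ℝ, ‖(a : X) - r • X.unit‖ ≤ R * L.norm a := by
  obtain ⟨R, hR₀, hR⟩ := L.exists_norm_sub_smul_unit_le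
  refine ⟨R, hR₀, fun a => ?_⟩
  rcases (apply_nonneg L.norm a).eq_or_lt with h | h
  · obtain ⟨r, hr⟩ := (L.norm_eq_zero_iff a).1 h.symm
    exact ⟨r, by rw [hr, sub_self, norm_zero, ← h, mul_zero]⟩
  · obtain ⟨r, hr⟩ := hR ((L.norm a)⁻¹ • a) (by
      rw [map_smul_eq_mul, Real.norm_eq_abs, abs_of_pos (inv_pos.2 h), inv_mul_cancel₀ h.ne'])
    refine ⟨L.norm a * r, ?_⟩
    have e : (a : X) - (L.norm a * r) • X.unit =
        L.norm a • ((((L.norm a)⁻¹ • a : L.domain) : X) - r • X.unit) := by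
      rw [smul_sub, Submodule.coe_smul, smul_smul, smul_smul, mul_inv_cancel₀ h.ne', one_smul]
    rw [e, norm_smul, Real.norm_eq_abs, abs_of_pos h, mul_comm]
    exact mul_le_mul_of_nonneg_right hr h.le

variable (φ : UCPMap X Y)

/-- The quotient of a Lip-norm under a u.c.p. map, as a seminorm on the image of the domain. -/
def quotientSeminorm : Seminorm ℝ (L.domain.map φ.toRealLin) :=
  L.norm.quotientMap (φ.toRealLin.submoduleMap L.domain) (φ.toRealLin.submoduleMap_surjective _)

theorem quotientSeminorm_le (a : L.domain) :
    L.quotientSeminorm φ ⟨φ.toLin a, a, a.2, rfl⟩ ≤ L.norm a :=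
  L.norm.quotientMap_apply_le _ _ a

theorem exists_lt_of_quotientSeminorm_lt {y : L.domain.map φ.toRealLin} {t : ℝ}
    (h : L.quotientSeminorm φ y < t) : ∃ a : L.domain, φ.toLin a = y ∧ L.norm a < t := by
  obtain ⟨a, ha, hat⟩ := L.norm.exists_lt_of_quotientMap_lt _ _ h
  exact ⟨a, congrArg Subtype.val ha, hat⟩

theorem isClosed_span_unit : IsClosed (Submodule.span ℝ {Y.unit} : Set Y) :=
  Submodule.closed_of_finiteDimensional _

/-- The unit ball of the quotient seminorm is closed: up to scalars, it is the image of a compact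
set. -/
theorem isClosed_quotientSeminorm_le_one [Nontrivial A] :
    IsClosed {y : Y | ∃ h : y ∈ L.domain.map φ.toRealLin, L.quotientSeminorm φ ⟨y, h⟩ ≤ 1} := by
  obtain ⟨R, -, hR⟩ := L.exists_norm_sub_smul_unit_le
  have hS : IsClosed (φ.toLin '' L.boundedBall R + (Submodule.span ℝ {Y.unit} : Set Y)) :=
    isClosed_span_unit.add_left_of_isCompact ((L.isCompact_boundedBall R).image φ.continuous)
  have hL : ∀ (a : L.domain) (r : ℝ), L.norm (a - r • ⟨X.unit, L.unit_mem⟩) ≤ L.norm a :=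
    fun a r => (map_sub_le_add L.norm _ _).trans (by
      rw [L.norm_real_smul_unit (r • ⟨X.unit, L.unit_mem⟩) r rfl, add_zero])
  have hmem : ∀ a : L.domain, L.norm a ≤ 1 →
      φ.toLin a ∈ φ.toLin '' L.boundedBall R + (Submodule.span ℝ {Y.unit} : Set Y) := by
    intro a ha
    obtain ⟨r, hr⟩ := hR a ha
    refine Set.mem_add.2 ⟨_, ⟨(a : X) - r • X.unit, ⟨⟨Subtype.property
      (a - r • ⟨X.unit, L.unit_mem⟩ : L.domain), (hL a r).trans ha⟩, hr⟩, rfl⟩, r • Y.unit,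
      Submodule.smul_mem _ _ (Submodule.mem_span_singleton_self _), ?_⟩
    rw [map_sub, φ.map_real_smul_unit, sub_add_cancel]
  convert hS using 1
  ext y
  constructor
  · rintro ⟨hy, hy₁⟩
    -- Multiples `c y` with `c < 1` close to `1` are images of elements with `L ≤ 1`.
    have hlim : Filter.Tendsto (fun n : ℕ => (1 + 1 / ((n : ℝ) + 1))⁻¹ • y) Filter.atTop
        (𝓝 y) := by
      have h := ((tendsto_const_nhds (x := (1 : ℝ))).add
        (tendsto_one_div_add_atTop_nhds_zero_nat (𝕜 := ℝ))).inv₀ (by norm_num)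
      simpa using h.smul_const y
    refine hS.mem_of_tendsto hlim (Filter.Eventually.of_forall fun n => ?_)
    have hn : 0 < 1 / ((n : ℝ) + 1) := by positivity
    have hn' : 0 < 1 + 1 / ((n : ℝ) + 1) := by linarith
    obtain ⟨a, ha, hat⟩ := L.exists_lt_of_quotientSeminorm_lt φ
      (t := 1 + 1 / ((n : ℝ) + 1)) (hy₁.trans_lt (by linarith))
    have h := hmem ((1 + 1 / ((n : ℝ) + 1))⁻¹ • a) (by
      rw [map_smul_eq_mul, Real.norm_eq_abs, abs_of_pos (inv_pos.2 hn'), inv_mul_le_iff₀ hn',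
        mul_one]
      exact hat.le)
    rwa [Submodule.coe_smul, φ.map_real_smul, ha] at h
  · rintro h
    obtain ⟨_, ⟨x, ⟨⟨hx, hx₁⟩, -⟩, rfl⟩, z, hz, rfl⟩ := Set.mem_add.1 h
    obtain ⟨r, rfl⟩ := Submodule.mem_span_singleton.1 hz
    let a : L.domain := ⟨x, hx⟩ - (-r) • ⟨X.unit, L.unit_mem⟩
    have e : φ.toLin x + r • Y.unit = φ.toLin a := by
      simp [a, φ.map_real_smul, φ.map_unit, sub_eq_add_neg]
    show ∃ h, _
    simp only [e]
    exact ⟨⟨a, a.2, rfl⟩, (L.quotientSeminorm_le φ a).trans ((hL ⟨x, hx⟩ (-r)).trans hx₁)⟩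

/-- The quotient of a Lip-norm under a surjective u.c.p. map onto a finite-dimensional operator
system; finite-dimensionality enters as properness of the norm. -/
def quotient [Nontrivial A] [ProperSpace Y] (hφ : Function.Surjective φ.toLin) : LipNorm Y where
  domain := L.domain.map φ.toRealLin
  selfAdjoint := by
    rintro _ ⟨x, hx, rfl⟩
    exact φ.isSelfAdjoint_map (L.selfAdjoint x hx)
  unit_mem := ⟨X.unit, L.unit_mem, φ.map_unit⟩
  dense y hy := by
    obtain ⟨x, rfl⟩ := hφ y
    obtain ⟨a, b, ha, hb, -, -, rfl⟩ := X.exists_re_im x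
    -- `φ a + i φ b` is self-adjoint, hence equal to `φ a`.
    have h : Complex.I • φ.toLin b = 0 := by
      have h₁ := φ.isSelfAdjoint_map ha
      have h₂ := φ.isSelfAdjoint_map hb
      rw [isSelfAdjoint_iff, map_add, map_smul, Submodule.coe_add, Submodule.coe_smul, star_add,
        star_smul, h₁.star_eq, h₂.star_eq, add_right_inj, Complex.star_def, Complex.conj_I,
        neg_smul, neg_eq_iff_add_eq_zero, ← two_smul ℂ, smul_eq_zero_iff_right two_ne_zero] at hy
      exact Subtype.ext hy
    rw [map_add, map_smul, h, add_zero]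
    exact map_mem_closure φ.continuous (L.dense a ha) fun x hx => ⟨x, hx, rfl⟩
  norm := L.quotientSeminorm φ
  norm_eq_zero_iff y := by
    constructor
    · intro hy
      obtain ⟨R, hR₀, hR⟩ := L.exists_norm_sub_smul_unit_le_mul
      have hmem : (y : Y) ∈ Submodule.span ℝ {Y.unit} := by
        refine isClosed_span_unit.closure_subset (Metric.mem_closure_iff.2 fun δ hδ => ?_)
        have hR₁ : 0 < R + 1 := by linarith
        obtain ⟨a, ha, hat⟩ := L.exists_lt_of_quotientSeminorm_lt φ (y := y) (t := δ / (R + 1))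
          (by rw [hy]; positivity)
        obtain ⟨r, hr⟩ := hR a
        refine ⟨r • Y.unit, Submodule.smul_mem _ _ (Submodule.mem_span_singleton_self _), ?_⟩
        rw [dist_eq_norm, ← ha]
        refine ((φ.norm_map_sub_smul_unit_le (L.selfAdjoint _ a.2) r).trans hr).trans_lt ?_
        rw [lt_div_iff₀ hR₁] at hat
        nlinarith [apply_nonneg L.norm a]
      obtain ⟨r, hr⟩ := Submodule.mem_span_singleton.1 hmem
      exact ⟨r, hr.symm⟩
    · rintro ⟨r, hr⟩
      have h := L.quotientSeminorm_le φ (r • ⟨X.unit, L.unit_mem⟩)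
      rw [L.norm_real_smul_unit (r • ⟨X.unit, L.unit_mem⟩) r rfl] at h
      refine le_antisymm (le_of_eq_of_le (congrArg _ (Subtype.ext ?_)) h) (apply_nonneg _ _)
      rw [hr]
      exact (φ.map_real_smul_unit r).symm
  nhds_basis := by
    obtain ⟨R, -, hR⟩ := L.exists_norm_sub_smul_unit_le_mul
    refine nhds_basis_of_totallyBounded (D := L.domain.map φ.toRealLin) (R := |R| * 2) ?_
      ⟨X.unit, L.unit_mem, φ.map_unit⟩ _ ?_ ?_ ?_
    · rintro _ ⟨x, hx, rfl⟩
      exact φ.isSelfAdjoint_map (L.selfAdjoint x hx)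
    · have h := L.quotientSeminorm_le φ ⟨X.unit, L.unit_mem⟩
      rw [L.norm_real_smul_unit ⟨X.unit, L.unit_mem⟩ 1 (one_smul _ _).symm] at h
      refine le_antisymm (le_of_eq_of_le (congrArg _ (Subtype.ext ?_)) h) (apply_nonneg _ _)
      exact φ.map_unit.symm
    · intro y hy
      obtain ⟨a, ha, hat⟩ := L.exists_lt_of_quotientSeminorm_lt φ (t := 2)
        (hy.trans_lt one_lt_two)
      obtain ⟨r, hr⟩ := hR a
      refine ⟨r, ?_⟩
      rw [← ha]
      refine ((φ.norm_map_sub_smul_unit_le (L.selfAdjoint _ a.2) r).trans hr).trans ?_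
      exact mul_le_mul (le_abs_self R) hat.le (apply_nonneg _ _) (abs_nonneg R)
    · refine (isCompact_closedBall (0 : Y) (|R| * 2)).totallyBounded.subset fun y hy => ?_
      rw [mem_closedBall_zero_iff]
      exact hy.2
  isClosed := L.isClosed_quotientSeminorm_le_one φ

end LipNorm

end Quotient

/-! ### Lip-norms on direct sums -/

namespace OperatorSystem

variable {A B : Type*} [CStarAlgebra A] [CStarAlgebra B] {X : OperatorSystem A}
  {Y : OperatorSystem B}

/-- The element `(x, y)` of the direct sum of two operator systems. -/
def pair (x : X) (y : Y) : X.sum Y := ⟨(x, y), x.2, y.2⟩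

@[simp] theorem fst_pair (x : X) (y : Y) : (UCPMap.fst X Y).toLin (pair x y) = x := rfl

@[simp] theorem snd_pair (x : X) (y : Y) : (UCPMap.snd X Y).toLin (pair x y) = y := rfl

theorem pair_fst_snd (p : X.sum Y) :
    pair ((UCPMap.fst X Y).toLin p) ((UCPMap.snd X Y).toLin p) = p := rfl

theorem norm_sum (p : X.sum Y) :
    ‖p‖ = max ‖(UCPMap.fst X Y).toLin p‖ ‖(UCPMap.snd X Y).toLin p‖ := rfl

theorem continuous_pair : Continuous fun q : X × Y => pair q.1 q.2 :=
  Continuous.subtype_mk (by fun_prop) _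

theorem isSelfAdjoint_sum_iff {p : X.sum Y} : IsSelfAdjoint (p : A × B) ↔
    IsSelfAdjoint ((UCPMap.fst X Y).toLin p : A) ∧
      IsSelfAdjoint ((UCPMap.snd X Y).toLin p : B) :=
  Prod.ext_iff

end OperatorSystem

namespace LipNorm

open OperatorSystem

variable {A B : Type*} [CStarAlgebra A] [CStarAlgebra B] {X : OperatorSystem A}
  {Y : OperatorSystem B} (LX : LipNorm X) (LY : LipNorm Y)

/-- The real subspace `𝒟(L_X) ⊕ 𝒟(L_Y)` of `X ⊕ Y`. -/
def sumDomain : Submodule ℝ (X.sum Y) :=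
  LX.domain.comap (UCPMap.fst X Y).toRealLin ⊓ LY.domain.comap (UCPMap.snd X Y).toRealLin

/-- The seminorm `(x, y) ↦ max (L_X x) (L_Y y) (‖x - ψ y‖ / ε) (‖φ x - y‖ / ε)`. -/
def bridgeSeminorm (φ : UCPMap X Y) (ψ : UCPMap Y X) (ε : ℝ) : Seminorm ℝ (LX.sumDomain LY) :=
  (LX.norm.comp ((UCPMap.fst X Y).toRealLin.restrict fun _ h => h.1) ⊔
    LY.norm.comp ((UCPMap.snd X Y).toRealLin.restrict fun _ h => h.2)) ⊔
  ((normSeminorm ℝ X).comp (ε⁻¹ • (((UCPMap.fst X Y).toRealLin -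
      ψ.toRealLin ∘ₗ (UCPMap.snd X Y).toRealLin) ∘ₗ (LX.sumDomain LY).subtype)) ⊔
    (normSeminorm ℝ Y).comp (ε⁻¹ • ((φ.toRealLin ∘ₗ (UCPMap.fst X Y).toRealLin -
      (UCPMap.snd X Y).toRealLin) ∘ₗ (LX.sumDomain LY).subtype)))

variable (φ : UCPMap X Y) (ψ : UCPMap Y X) {ε : ℝ}

theorem bridgeSeminorm_le_iff (hε : 0 < ε) (p : LX.sumDomain LY) (c : ℝ) :
    LX.bridgeSeminorm LY φ ψ ε p ≤ c ↔
      (LX.norm ⟨(UCPMap.fst X Y).toLin p, p.2.1⟩ ≤ c ∧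
        LY.norm ⟨(UCPMap.snd X Y).toLin p, p.2.2⟩ ≤ c) ∧
      ‖(UCPMap.fst X Y).toLin p - ψ.toLin ((UCPMap.snd X Y).toLin p)‖ ≤ ε * c ∧
      ‖φ.toLin ((UCPMap.fst X Y).toLin p) - (UCPMap.snd X Y).toLin p‖ ≤ ε * c := by
  have h₁ : ‖ε⁻¹ • ((UCPMap.fst X Y).toLin p - ψ.toLin ((UCPMap.snd X Y).toLin p))‖ ≤ c ↔
      ‖(UCPMap.fst X Y).toLin p - ψ.toLin ((UCPMap.snd X Y).toLin p)‖ ≤ ε * c := by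
    rw [norm_smul, Real.norm_eq_abs, abs_of_pos (inv_pos.2 hε), inv_mul_le_iff₀ hε]
  have h₂ : ‖ε⁻¹ • (φ.toLin ((UCPMap.fst X Y).toLin p) - (UCPMap.snd X Y).toLin p)‖ ≤ c ↔
      ‖φ.toLin ((UCPMap.fst X Y).toLin p) - (UCPMap.snd X Y).toLin p‖ ≤ ε * c := by
    rw [norm_smul, Real.norm_eq_abs, abs_of_pos (inv_pos.2 hε), inv_mul_le_iff₀ hε]
  rw [← h₁, ← h₂, ← max_le_iff, ← max_le_iff, ← max_le_iff]
  rfl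

theorem sumDomain_isSelfAdjoint (p : X.sum Y) (hp : p ∈ LX.sumDomain LY) :
    IsSelfAdjoint (p : A × B) :=
  isSelfAdjoint_sum_iff.2 ⟨LX.selfAdjoint _ hp.1, LY.selfAdjoint _ hp.2⟩

theorem bridgeSeminorm_eq_zero_iff (hε : 0 < ε) (p : LX.sumDomain LY) :
    LX.bridgeSeminorm LY φ ψ ε p = 0 ↔ ∃ r : ℝ, (p : X.sum Y) = r • (X.sum Y).unit := by
  rw [← (apply_nonneg _ p).ge_iff_eq', bridgeSeminorm_le_iff LX LY φ ψ hε, mul_zero]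
  constructor
  · rintro ⟨⟨h₁, -⟩, -, h₂⟩
    obtain ⟨r, hr⟩ := (LX.norm_eq_zero_iff _).1 (le_antisymm h₁ (apply_nonneg _ _))
    refine ⟨r, ?_⟩
    have hr' : (UCPMap.fst X Y).toLin p = r • X.unit := hr
    rw [norm_le_zero_iff, sub_eq_zero, hr', φ.map_real_smul_unit] at h₂
    rw [← pair_fst_snd (p : X.sum Y), hr', ← h₂]
    rfl
  · rintro ⟨r, hr⟩
    have h₁ : (UCPMap.fst X Y).toLin p = r • X.unit := by rw [hr]; rfl
    have h₂ : (UCPMap.snd X Y).toLin p = r • Y.unit := by rw [hr]; rfl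
    refine ⟨⟨(LX.norm_real_smul_unit _ r h₁).le, (LY.norm_real_smul_unit _ r h₂).le⟩, ?_, ?_⟩
    · rw [h₁, h₂, ψ.map_real_smul_unit, sub_self, norm_zero]
    · rw [h₁, h₂, φ.map_real_smul_unit, sub_self, norm_zero]

/-- The Lip-norm `(x, y) ↦ max (L_X x) (L_Y y) (‖x - ψ y‖ / ε) (‖φ x - y‖ / ε)` on `X ⊕ Y`. -/
def bridge [Nontrivial A] (hε : 0 < ε) : LipNorm (X.sum Y) where
  domain := LX.sumDomain LY
  selfAdjoint := LX.sumDomain_isSelfAdjoint LY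
  unit_mem := ⟨LX.unit_mem, LY.unit_mem⟩
  dense p hp := by
    have h : ((UCPMap.fst X Y).toLin p, (UCPMap.snd X Y).toLin p) ∈
        closure ((LX.domain : Set X) ×ˢ (LY.domain : Set Y)) := by
      rw [closure_prod_eq]
      exact ⟨LX.dense _ (isSelfAdjoint_sum_iff.1 hp).1, LY.dense _ (isSelfAdjoint_sum_iff.1 hp).2⟩
    exact map_mem_closure continuous_pair h fun q hq => ⟨hq.1, hq.2⟩
  norm := LX.bridgeSeminorm LY φ ψ ε
  norm_eq_zero_iff := LX.bridgeSeminorm_eq_zero_iff LY φ ψ hε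
  nhds_basis := by
    obtain ⟨R, -, hR⟩ := LX.exists_norm_sub_smul_unit_le
    refine nhds_basis_of_totallyBounded (R := R + ε) (LX.sumDomain_isSelfAdjoint LY)
      ⟨LX.unit_mem, LY.unit_mem⟩ _ ?_ (fun p hp => ?_) ?_
    · exact (LX.bridgeSeminorm_eq_zero_iff LY φ ψ hε _).2 ⟨1, (one_smul _ _).symm⟩
    · rw [bridgeSeminorm_le_iff LX LY φ ψ hε, mul_one] at hp
      obtain ⟨⟨h₁, -⟩, -, h₂⟩ := hp
      obtain ⟨r, hr⟩ := hR _ h₁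
      refine ⟨r, ?_⟩
      rw [norm_sum, map_sub, map_sub, UCPMap.map_real_smul_unit, UCPMap.map_real_smul_unit]
      refine max_le (by linarith) ?_
      calc ‖(UCPMap.snd X Y).toLin p - r • Y.unit‖
          ≤ ‖(UCPMap.snd X Y).toLin p - φ.toLin ((UCPMap.fst X Y).toLin p)‖ +
            ‖φ.toLin ((UCPMap.fst X Y).toLin p) - r • Y.unit‖ :=
              norm_sub_le_norm_sub_add_norm_sub _ _ _
        _ ≤ ε + R := add_le_add (by rwa [norm_sub_rev])
            ((φ.norm_map_sub_smul_unit_le (LX.selfAdjoint _ p.2.1) r).trans hr)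
        _ = R + ε := add_comm _ _
    · refine (((LX.isCompact_boundedBall (R + ε)).prod (LY.isCompact_boundedBall (R + ε))).image
        continuous_pair).totallyBounded.subset ?_
      rintro p ⟨⟨hp, hp₁⟩, hpR⟩
      rw [bridgeSeminorm_le_iff LX LY φ ψ hε] at hp₁
      rw [norm_sum, max_le_iff] at hpR
      exact ⟨((UCPMap.fst X Y).toLin p, (UCPMap.snd X Y).toLin p),
        ⟨⟨⟨hp.1, hp₁.1.1⟩, hpR.1⟩, ⟨hp.2, hp₁.1.2⟩, hpR.2⟩, rfl⟩
  isClosed := by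
    have hf := (UCPMap.fst X Y).continuous
    have hs := (UCPMap.snd X Y).continuous
    have hφ := φ.continuous
    have hψ := ψ.continuous
    have h := ((LX.isClosed.preimage hf).inter (LY.isClosed.preimage hs)).inter
      ((isClosed_le (hf.sub (hψ.comp hs)).norm (continuous_const (y := ε * 1))).inter
        (isClosed_le ((hφ.comp hf).sub hs).norm (continuous_const (y := ε * 1))))
    convert h using 1
    ext p
    constructor
    · rintro ⟨hp, hp₁⟩
      rw [bridgeSeminorm_le_iff LX LY φ ψ hε] at hp₁
      exact ⟨⟨⟨hp.1, hp₁.1.1⟩, ⟨hp.2, hp₁.1.2⟩⟩, hp₁.2⟩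
    · rintro ⟨⟨⟨h₁, h₁'⟩, ⟨h₂, h₂'⟩⟩, h₃⟩
      exact ⟨⟨h₁, h₂⟩, (bridgeSeminorm_le_iff LX LY φ ψ hε ⟨p, h₁, h₂⟩ 1).2 ⟨⟨h₁', h₂'⟩, h₃⟩⟩

/-- If `ψ ∘ φ` is within `ε` of the identity on the unit ball of `L`, then the bridge between `L`
and its quotient under `φ` induces both: the point over `x` is `φ x`. -/
theorem bridge_induces [Nontrivial A] [ProperSpace Y] (L : LipNorm X)
    (hφ : Function.Surjective φ.toLin) (hε : 0 < ε)
    (h : ∀ a : L.domain, L.norm a ≤ 1 → ‖ψ.toLin (φ.toLin a) - a‖ ≤ ε) :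
    (L.bridge (L.quotient φ hφ) φ ψ hε).Induces L (L.quotient φ hφ) := by
  have hscale : ∀ a : L.domain, ‖(a : X) - ψ.toLin (φ.toLin a)‖ ≤ ε * L.norm a := by
    intro a
    refine le_of_forall_gt_imp_ge_of_dense fun t ht => ?_
    rw [mul_comm, ← lt_div_iff₀ hε] at ht
    have ht₀ : 0 < t / ε := (apply_nonneg L.norm a).trans_lt ht
    have := h ((t / ε)⁻¹ • a) (by
      rw [map_smul_eq_mul, Real.norm_eq_abs, abs_of_pos (inv_pos.2 ht₀), inv_mul_le_iff₀ ht₀,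
        mul_one]
      exact ht.le)
    rw [Submodule.coe_smul, φ.map_real_smul, ψ.map_real_smul, ← smul_sub, norm_smul,
      Real.norm_eq_abs, abs_of_pos (inv_pos.2 ht₀), inv_mul_le_iff₀ ht₀, div_mul_cancel₀ _ hε.ne',
      norm_sub_rev] at this
    exact this
  have hle : ∀ a : L.domain, L.bridgeSeminorm (L.quotient φ hφ) φ ψ ε
      ⟨pair (a : X) (φ.toLin a), a.2, a, a.2, rfl⟩ ≤ L.norm a := fun a => by
    rw [bridgeSeminorm_le_iff _ _ φ ψ hε]
    refine ⟨⟨le_rfl, L.quotientSeminorm_le φ a⟩, hscale a, ?_⟩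
    simpa using mul_nonneg hε.le (apply_nonneg L.norm a)
  refine ⟨fun p => Iff.rfl, fun x => ?_, fun y => ⟨?_, fun b hb => ?_⟩⟩
  · refine IsLeast.isGLB ⟨⟨⟨pair (x : X) (φ.toLin x), x.2, x, x.2, rfl⟩, rfl, ?_⟩, ?_⟩
    · refine le_antisymm ?_ (hle x)
      exact ((bridgeSeminorm_le_iff L (L.quotient φ hφ) φ ψ hε
        ⟨pair (x : X) (φ.toLin x), x.2, x, x.2, rfl⟩ _).1 le_rfl).1.1
    · rintro _ ⟨p, hp, rfl⟩
      have := ((bridgeSeminorm_le_iff L (L.quotient φ hφ) φ ψ hε p _).1 le_rfl).1.1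
      simp only [hp] at this
      exact this
  · rintro _ ⟨p, hp, rfl⟩
    have := ((bridgeSeminorm_le_iff L (L.quotient φ hφ) φ ψ hε p _).1 le_rfl).1.2
    simp only [hp] at this
    exact this
  · refine le_of_forall_gt_imp_ge_of_dense fun t ht => ?_
    obtain ⟨a, ha, hat⟩ := L.exists_lt_of_quotientSeminorm_lt φ ht
    exact (hb ⟨⟨pair (a : X) (φ.toLin a), a.2, a, a.2, rfl⟩, ha, rfl⟩).trans
      ((hle a).trans hat.le)

/-- In the bridge Lip-norm, composition with `φ` and `ψ` moves matrix states by at most `ε`. -/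
theorem ucpHausdorffDist_bridge_le [Nontrivial A] (hε : 0 < ε) (n : ℕ) :
    (LX.bridge LY φ ψ hε).ucpHausdorffDist n ≤ ENNReal.ofReal ε := by
  let _ := (LX.bridge LY φ ψ hε).ucpMetric n
  refine Metric.hausdorffEDist_le_of_mem_edist ?_ ?_
  · rintro _ ⟨θ, rfl⟩
    refine ⟨_, ⟨θ.comp ψ, rfl⟩, iSup₂_le fun p hp => ENNReal.ofReal_le_ofReal ?_⟩
    have h := ((bridgeSeminorm_le_iff LX LY φ ψ hε p 1).1 hp).2.1
    rw [mul_one] at h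
    refine le_trans ?_ h
    have e := θ.norm_map_le (x := (UCPMap.fst X Y).toLin p -
        ψ.toLin ((UCPMap.snd X Y).toLin p))
      ((LX.selfAdjoint _ p.2.1).sub (ψ.isSelfAdjoint_map (LY.selfAdjoint _ p.2.2)))
    rwa [map_sub] at e
  · rintro _ ⟨θ, rfl⟩
    refine ⟨_, ⟨θ.comp φ, rfl⟩, iSup₂_le fun p hp => ENNReal.ofReal_le_ofReal ?_⟩
    have h := ((bridgeSeminorm_le_iff LX LY φ ψ hε p 1).1 hp).2.2
    rw [mul_one] at h
    refine le_trans ?_ h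
    have e := θ.norm_map_le (x := φ.toLin ((UCPMap.fst X Y).toLin p) -
        (UCPMap.snd X Y).toLin p)
      ((φ.isSelfAdjoint_map (LX.selfAdjoint _ p.2.1)).sub (LY.selfAdjoint _ p.2.2))
    rw [map_sub, norm_sub_rev] at e
    exact e

theorem completeDist_quotient_le [Nontrivial A] [ProperSpace Y] (L : LipNorm X)
    (hφ : Function.Surjective φ.toLin) (hε : 0 < ε)
    (h : ∀ a : L.domain, L.norm a ≤ 1 → ‖ψ.toLin (φ.toLin a) - a‖ ≤ ε) :
    completeDist L (L.quotient φ hφ) ≤ ENNReal.ofReal ε :=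
  iInf₂_le_of_le (L.bridge (L.quotient φ hφ) φ ψ hε) (bridge_induces φ ψ L hφ hε h)
    (iSup₂_le fun n _ => ucpHausdorffDist_bridge_le L (L.quotient φ hφ) φ ψ hε n)

end LipNorm

/-! ### Images of u.c.p. maps in matrix algebras -/

/-- The block-diagonal embedding of `M_{n₁} ⊕ ⋯ ⊕ M_{n_m}` into `M_{n₁ + ⋯ + n_m}`. -/
def blockEmbedding {m : ℕ} (n : Fin m → ℕ) :
    ((i : Fin m) → MatAlg (n i)) →⋆ₐ[ℂ] MatAlg (∑ i, n i) where
  toFun M := Matrix.reindexAlgEquiv ℂ ℂ finSigmaFinEquiv (Matrix.blockDiagonal' M)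
  map_one' := by rw [Matrix.blockDiagonal'_one, map_one]
  map_mul' M N := by rw [← map_mul, ← Matrix.blockDiagonal'_mul]; rfl
  map_zero' := by rw [Matrix.blockDiagonal'_zero, map_zero]
  map_add' M N := by rw [Matrix.blockDiagonal'_add, map_add]
  commutes' r := by
    rw [Algebra.algebraMap_eq_smul_one, Matrix.blockDiagonal'_smul, Matrix.blockDiagonal'_one,
      map_smul, map_one, Algebra.algebraMap_eq_smul_one]
  map_star' M := by
    simp only [Matrix.star_eq_conjTranspose, Matrix.coe_reindexAlgEquiv,
      Matrix.conjTranspose_reindex, Matrix.blockDiagonal'_conjTranspose]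
    rfl

theorem blockEmbedding_injective {m : ℕ} (n : Fin m → ℕ) :
    Function.Injective (blockEmbedding n) :=
  (Matrix.reindexAlgEquiv ℂ ℂ finSigmaFinEquiv).injective.comp Matrix.blockDiagonal'_injective

namespace UCPMap

variable {A B C : Type*} [CStarAlgebra A] [CStarAlgebra B] [CStarAlgebra C]
  [FiniteDimensional ℂ C] {X : OperatorSystem A} (α : UCPMap X (OperatorSystem.univ B))
  (ι : B →⋆ₐ[ℂ] C)

/-- The linear map `ι ∘ α` into the ambient algebra. -/
def imageLin : X →ₗ[ℂ] C :=
  ι.toLinearMap ∘ₗ (OperatorSystem.univ B).toSubmodule.subtype ∘ₗ α.toLin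

/-- The image of `ι ∘ α`, an operator subsystem of the finite-dimensional algebra `C`. -/
def image : OperatorSystem C where
  toSubmodule := LinearMap.range (α.imageLin ι)
  one_mem' := ⟨X.unit, by
    show ι (α.toLin X.unit : B) = 1
    rw [α.map_unit, OperatorSystem.coe_unit, map_one]⟩
  star_mem' := by
    rintro _ ⟨x, rfl⟩
    refine ⟨⟨star (x : A), X.star_mem' x.2⟩, ?_⟩
    show ι (α.toLin _ : B) = star (ι (α.toLin x : B))
    rw [α.toLin_star, map_star]
  isClosed' := Submodule.closed_of_finiteDimensional _

/-- The u.c.p. map `ι ∘ α` onto its image. -/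
def toImage : UCPMap X (α.image ι) where
  toLin := (α.imageLin ι).rangeRestrict
  map_unit := Subtype.ext (by
    show ι (α.toLin X.unit : B) = 1
    rw [α.map_unit, OperatorSystem.coe_unit, map_one])
  map_pos n M hM := (α.map_pos n M hM).matrix_map (ι : B →⋆ₙₐ[ℂ] C)

theorem toImage_surjective : Function.Surjective (α.toImage ι).toLin :=
  (α.imageLin ι).surjective_rangeRestrict

/-- The inverse of an injective `ι` on the image of `ι ∘ α`. -/
def imageInv (hι : Function.Injective ι) : α.image ι →ₗ[ℂ] OperatorSystem.univ B :=
  LinearMap.codRestrict (OperatorSystem.univ B).toSubmodule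
    ((LinearEquiv.ofInjective ι.toLinearMap hι).symm.toLinearMap ∘ₗ
      Submodule.inclusion (by rintro _ ⟨x, rfl⟩; exact ⟨_, rfl⟩)) fun _ => trivial

theorem apply_imageInv (hι : Function.Injective ι) (y : α.image ι) :
    ι (α.imageInv ι hι y : B) = y :=
  congrArg Subtype.val ((LinearEquiv.ofInjective ι.toLinearMap hι).apply_symm_apply _)

/-- For injective `ι`, a u.c.p. map `β` on `B` transports to the image of `ι ∘ α`. -/
def ofImage (hι : Function.Injective ι) (β : UCPMap (OperatorSystem.univ B) X) :
    UCPMap (α.image ι) X where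
  toLin := β.toLin ∘ₗ α.imageInv ι hι
  map_unit := by
    have h : α.imageInv ι hι (α.image ι).unit = (OperatorSystem.univ B).unit := by
      apply Subtype.ext
      apply hι
      rw [apply_imageInv, OperatorSystem.coe_unit, OperatorSystem.coe_unit, map_one]
    rw [LinearMap.comp_apply, h, β.map_unit]
  map_pos n M hM := by
    refine β.map_pos n (M.map (α.imageInv ι hι))
      (isPos_of_isPos_matrix_map (ι : B →⋆ₙₐ[ℂ] C) hι ?_)
    convert hM using 1
    ext i j
    exact α.apply_imageInv ι hι (M i j)

theorem ofImage_toImage (hι : Function.Injective ι) (β : UCPMap (OperatorSystem.univ B) X)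
    (x : X) : (α.ofImage ι hι β).toLin ((α.toImage ι).toLin x) = β.toLin (α.toLin x) := by
  refine congrArg β.toLin (Subtype.ext (hι ?_))
  rw [apply_imageInv]
  rfl

end UCPMap

end

theorem mainTheorem11 {A : Type*} [CStarAlgebra A] [Nontrivial A] (X : OperatorSystem A)
    (L : LipNorm X) (hX : X.IsNuclear) (ε : ℝ) (hε : 0 < ε) :
    L.Afn ε ≤ L.Rcp ε := by
  refine le_iInf fun t => ?_
  obtain ⟨B, α, β, hαβ⟩ := t
  refine le_iInf fun m => le_iInf fun n => le_iInf fun ⟨e⟩ => ?_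
  let ι : B →⋆ₐ[ℂ] MatAlg (∑ i, n i) := (blockEmbedding n).comp e
  have hι : Function.Injective ι := (blockEmbedding_injective n).comp e.injective
  -- `X` is nonzero, hence so is `B`, and the matrices have positive size.
  have hk : 1 ≤ ∑ i, n i := by
    by_contra h
    have h₀ : ∑ i, n i = 0 := by omega
    have : IsEmpty (Fin (∑ i, n i)) := by rw [h₀]; infer_instance
    have hB : (1 : B) = 0 := hι (Subsingleton.elim _ _)
    have hu : (OperatorSystem.univ B).unit = 0 := Subtype.ext hB
    have h₁ := β.map_unit
    rw [hu, map_zero] at h₁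
    exact zero_ne_one (congrArg (Subtype.val : X → A) h₁)
  have : ProperSpace (α.image ι) := FiniteDimensional.proper ℂ _
  refine iInf₂_le_of_le (∑ i, n i) hk (iInf₂_le_of_le (α.image ι)
    (L.quotient (α.toImage ι) (α.toImage_surjective ι)) (iInf_le_of_le ?_ le_rfl))
  refine LipNorm.completeDist_quotient_le _ (α.ofImage ι hι β) L _ hε fun a ha => ?_
  rw [UCPMap.ofImage_toImage]
  exact (hαβ a ha).le
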